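/- Let $\mathcal X,\mathcal Y$ be finite alphabets and let $d:\mathcal X\times\mathcal Y\to[0,\infty)$ be a distortion measure such that for every $x\in\mathcal X$ there is a $y\in\mathcal Y$ with $d(x,y)=0$. Write $\mathcal P(\cdot)$ for the set of probability distributions on a finite set, $\mathcal P(\mathcal Y|\mathcal X)$ for the set of conditional distributions on $\mathcal Y$ given $\mathcal X$, and $\log$ for the natural logarithm. For $q\in\mathcal P(\mathcal X)$ and $V\in\mathcal P(\mathcal Y|\mathcal X)$ let $I(q,V)=\sum_{x,y}q(x)V(y|x)\log\frac{V(y|x)}{\sum_{x'}q(x')V(y|x')}$ be the mutual information, let $$R(\Delta|q)=\min\Big\{I(q,V): V\in\mathcal P(\mathcal Y|\mathcal X),\ \sum_{x,y}q(x)V(y|x)d(x,y)\le\Delta\Big\}$$ be the rate-distortion function, and let $D(q\|P)=\sum_x q(x)\log\frac{q(x)}{P(x)}$ be the relative entropy (equal to $+\infty$ if $q(x)>0=P(x)$ for some $x$). For $\mu,\nu\ge0$, $P\in\mathcal P(\mathcal X)$ and $p_Y\in\mathcal P(\mathcal Y)$ put $$G^{(\mu,\nu)}(p_Y|P)=\begin{cases}\mu\log\sum_x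 P(x)\Big\{\sum_y p_Y(y)e^{-\nu d(x,y)}\Big\}^{-1/\mu}&\text{if }\mu>0,\\[1ex]-\log\min_x\sum_y p_Y(y)e^{-\nu d(x,y)}&\text{if }\mu=0.\end{cases}$$ **Theorem.** For any $P\in\mathcal P(\mathcal X)$, any $E\ge0$ and any $0\le\Delta\le\Delta_{\max}:=\min_y\sum_x P(x)d(x,y)$, the inverse Marton exponent $$R_{\rm M}(E|\Delta,P)=\max\{R(\Delta|q): q\in\mathcal P(\mathcal X),\ D(q\|P)\le E\}$$ satisfies $$R_{\rm M}(E|\Delta,P)=\sup_{\nu\ge0}\ \inf_{\mu\ge0}\Big[-\nu\Delta+\mu E+\min_{p_Y\in\mathcal P(\mathcal Y)}G^{(\mu,\nu)}(p_Y|P)\Big].$$ Here the minimum defining $R(\Delta|q)$ (for every $q\in\mathcal P(\mathcal X)$), the maximum defining $R_{\rm M}(E|\Delta,P)$, and the minimum of $G^{(\mu,\nu)}(\cdot|P)$ over $\mathcal P(\mathcal Y)$ (for all $\mu,\nu\ge0$) are attained. Moreover, for all $\mu,\nu\ge0$, $G^{(\mu,\nu)}(p_Y|P)$ is convex in $p_Y\in\mathcal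 P(\mathcal Y)$. -/

import Mathlib

open scoped BigOperators

namespace Marton

variable {X Y : Type*} [Fintype X] [Fintype Y]

/-- Relative entropy `D(q‖p) = ∑ₓ q(x) log (q(x) / p(x))` (natural logarithm) of two probability
vectors on a finite alphabet, with the conventions `0 log (0 / a) = 0` for `a ≥ 0`, and
`D(q‖p) = +∞` if `q` is not absolutely continuous with respect to `p`. -/
noncomputable def relEntropy (q p : X → ℝ) : EReal :=
  open Classical in
  if ∀ x, p x = 0 → q x = 0 then ((∑ x, q x * Real.log (q x / p x) : ℝ) : EReal) else ⊤

/-- The set `𝒫(𝒴|𝒳)` of conditional probability distributions; `V x y` stands for `V(y|x)`. -/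
def channels (X Y : Type*) [Fintype Y] : Set (X → Y → ℝ) :=
  {V | ∀ x, V x ∈ stdSimplex ℝ Y}

/-- Mutual information `I(q, V) = ∑ₓ ∑_y q(x) V(y|x) log (V(y|x) / ∑_{x'} q(x') V(y|x'))`
(natural logarithm; terms with `q(x) V(y|x) = 0` vanish). -/
noncomputable def mutualInfo (q : X → ℝ) (V : X → Y → ℝ) : ℝ :=
  ∑ x, ∑ y, q x * V x y * Real.log (V x y / ∑ x', q x' * V x' y)

/-- Expected distortion `E_{q,V}[d(X,Y)]`. -/
noncomputable def expDistortion (d : X → Y → ℝ) (q : X → ℝ) (V : X → Y → ℝ) : ℝ :=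
  ∑ x, ∑ y, q x * V x y * d x y

/-- The values `I(q, V)` over all channels `V` with expected distortion at most `Δ`. -/
def rateSet (d : X → Y → ℝ) (Δ : ℝ) (q : X → ℝ) : Set ℝ :=
  mutualInfo q '' {V | V ∈ channels X Y ∧ expDistortion d q V ≤ Δ}

/-- The rate-distortion function `R(Δ|q)`. -/
noncomputable def rateDistortion (d : X → Y → ℝ) (Δ : ℝ) (q : X → ℝ) : ℝ :=
  sInf (rateSet d Δ q)

/-- The values `R(Δ|q)` over all probability distributions `q` with `D(q‖P) ≤ E`. -/
def invMartonSet (d : X → Y → ℝ) (E Δ : ℝ) (P : X → ℝ) : Set ℝ :=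
  rateDistortion d Δ '' {q | q ∈ stdSimplex ℝ X ∧ relEntropy q P ≤ (E : EReal)}

/-- The inverse Marton exponent `R_M(E|Δ,P)`. -/
noncomputable def invMarton (d : X → Y → ℝ) (E Δ : ℝ) (P : X → ℝ) : ℝ :=
  sSup (invMartonSet d E Δ P)

/-- `Δ_max = min_y ∑ₓ P(x) d(x,y)`. -/
noncomputable def maxDistortion (d : X → Y → ℝ) (P : X → ℝ) : ℝ :=
  ⨅ y, ∑ x, P x * d x y

/-- The function `G^{(μ,ν)}(p_Y|P)`, for `μ ≥ 0`. -/
noncomputable def G (d : X → Y → ℝ) (μ ν : ℝ) (P : X → ℝ) (p : Y → ℝ) : ℝ :=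
  open Classical in
  if μ = 0 then -Real.log (⨅ x, ∑ y, p y * Real.exp (-ν * d x y))
  else μ * Real.log (∑ x, P x * (∑ y, p y * Real.exp (-ν * d x y)) ^ (-1 / μ))

/-- `min_{p_Y} G^{(μ,ν)}(p_Y|P)` over all probability distributions `p_Y` on `Y`. -/
noncomputable def minG (d : X → Y → ℝ) (μ ν : ℝ) (P : X → ℝ) : ℝ :=
  sInf (G d μ ν P '' stdSimplex ℝ Y)

end Marton

/-! Write F(q,p) for `tiltedCost d ν q p`. Two variational formulas carry the proof. The log-sum
inequality and Gibbs channels give min over V of I(q,V) + ν E[d] = min over p of F(q,p), so Lagrange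
duality turns R(Δ|q) into sup over ν of min over p of -νΔ + F(q,p)
(`exists_multiplier_of_lt_rateDistortion`, `exists_tiltedCost_le_rateDistortion`). The Gibbs
principle gives G(p) = max over q of F(q,p) - μ D(q‖P) (`lagrangian_le_G`,
`exists_lagrangian_eq_G`).

For "≤", an optimal q and a nearly optimal ν for it suffice: D(q‖P) ≤ E bounds every μE + G(p) below
by F(q,p). For "≥", ν is fixed and weak duality gives each q in the entropy ball its own p; a
minimax exchange of q with the pair (p, μ) (`exists_G_lt`) yields one pair for all q, and maximizing
over q produces G. The exchange works because F is linear in q and convex in p. Concavity of R(Δ|·)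
is never needed, since ν stays outermost. -/

/-- One-sided form of Sion's minimax theorem for real-valued functions: only the first set has to be
compact. -/
theorem exists_forall_lt_of_minimax {E F : Type*}
    [TopologicalSpace E] [AddCommGroup E] [Module ℝ E] [IsTopologicalAddGroup E]
    [ContinuousSMul ℝ E]
    [TopologicalSpace F] [AddCommGroup F] [Module ℝ F] [IsTopologicalAddGroup F]
    [ContinuousSMul ℝ F] {A : Set E} {B : Set F} {f : E → F → ℝ}
    (neA : A.Nonempty) (cA : Convex ℝ A) (kA : IsCompact A) (cB : Convex ℝ B)
    (hf : ∀ y ∈ B, ContinuousOn (fun x => f x y) A)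
    (hf' : ∀ y ∈ B, ConvexOn ℝ A fun x => f x y)
    (hg : ∀ x ∈ A, ContinuousOn (fun y => f x y) B)
    (hg' : ∀ x ∈ A, ConcaveOn ℝ B fun y => f x y)
    {t : ℝ} (ht : ∀ x ∈ A, ∃ y ∈ B, t < f x y) :
    ∃ y ∈ B, ∀ x ∈ A, t < f x y := by
  have hfl : ∀ y ∈ B, LowerSemicontinuousOn (fun x => f x y) A :=
    fun y hy => (hf y hy).lowerSemicontinuousOn
  -- Compactness of A reduces the choice of y to finitely many points, which replaces compactness of
  -- B.
  obtain ⟨s, hs⟩ : ∃ s : Finset B, ∀ x ∈ A, ∃ i ∈ s, t < f x i := by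
    rw [← LowerSemicontinuousOn.inter_biInter_preimage_Iic_eq_empty_iff_exists_finset kA hfl]
    apply Set.eq_empty_of_forall_notMem
    rintro x ⟨hx, hx'⟩
    simp only [Set.mem_iInter, Set.mem_preimage, Set.mem_Iic] at hx'
    obtain ⟨y, hy, hty⟩ := ht x hx
    exact absurd (hx' y hy) (not_le.mpr hty)
  refine Sion.exists_lt_iInf_of_lt_iInf_of_finite neA kA hfl
    (fun y hy => (hf' y hy).quasiconvexOn) cB
    (fun x hx => (hg x hx).upperSemicontinuousOn) (fun x hx => (hg' x hx).quasiconcaveOn) cA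
    (s := Subtype.val '' (s : Set B)) (s.finite_toSet.image _) (Subtype.coe_image_subset _ _) ?_
  intro x hx
  obtain ⟨i, hi, h⟩ := hs x hx
  exact ⟨i, ⟨i, hi, rfl⟩, h⟩

/-! ### Inequalities for u log (u / v) -/

/-- This is log s ≤ s - 1 at s = b / a. For b = 0 < a it would fail, because `a / 0 = 0` and
`Real.log 0 = 0`; `hab` excludes that case. -/
theorem sub_le_mul_log_div {a b : ℝ} (ha : 0 ≤ a) (hb : 0 ≤ b) (hab : b = 0 → a = 0) :
    a - b ≤ a * Real.log (a / b) := by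
  rcases ha.eq_or_lt with rfl | ha
  · simpa using hb
  have hb : 0 < b := hb.lt_of_ne fun h => ha.ne' (hab h.symm)
  have h := Real.log_le_sub_one_of_pos (div_pos hb ha)
  rw [← inv_div, Real.log_inv]
  have : a * Real.log (b / a) ≤ a * (b / a - 1) := mul_le_mul_of_nonneg_left h ha.le
  have e : a * (b / a - 1) = b - a := by field_simp
  linarith

/-- Log-sum inequality for a probability vector `a` and a nonnegative vector `b`. -/
theorem neg_log_sum_le {ι : Type*} [Fintype ι] {a b : ι → ℝ} (ha : a ∈ stdSimplex ℝ ι)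
    (hb : ∀ i, 0 ≤ b i) (hab : ∀ i, b i = 0 → a i = 0) :
    -Real.log (∑ i, b i) ≤ ∑ i, a i * Real.log (a i / b i) := by
  have hs : 0 < ∑ i, b i := by
    refine (Finset.sum_nonneg fun i _ => hb i).lt_of_ne fun h => ?_
    have h0 := (Finset.sum_eq_zero_iff_of_nonneg fun i _ => hb i).1 h.symm
    have := ha.2
    rw [Finset.sum_eq_zero fun i hi => hab i (h0 i hi)] at this
    exact zero_ne_one this
  set S := ∑ i, b i
  -- After normalizing b to a probability vector, the left sides sum to 1 - 1 = 0.
  have key : ∀ i, a i - b i / S ≤ a i * Real.log (a i / b i) + a i * Real.log S := by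
    intro i
    have h := sub_le_mul_log_div (ha.1 i) (div_nonneg (hb i) hs.le)
      (fun h => hab i ((div_eq_zero_iff.1 h).resolve_right hs.ne'))
    rcases (ha.1 i).eq_or_lt with h0 | h0
    · simpa [← h0] using h
    · have hbi : b i ≠ 0 := fun h => h0.ne' (hab i h)
      have e : a i / (b i / S) = a i / b i * S := by field_simp
      rw [e, Real.log_mul (div_ne_zero h0.ne' hbi) hs.ne', mul_add] at h
      exact h
  have := Finset.sum_le_sum fun i (_ : i ∈ Finset.univ) => key i
  rw [Finset.sum_sub_distrib, Finset.sum_add_distrib, ← Finset.sum_mul, ← Finset.sum_div, ha.2,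
    div_self hs.ne'] at this
  linarith

/-- Joint convexity of `(u, v) ↦ u log (u / v)`. -/
theorem mul_log_div_convex {a b u₁ u₂ v₁ v₂ : ℝ} (ha : 0 < a) (hb : 0 < b)
    (hu₁ : 0 ≤ u₁) (hu₂ : 0 ≤ u₂) (hv₁ : 0 ≤ v₁) (hv₂ : 0 ≤ v₂)
    (h₁ : v₁ = 0 → u₁ = 0) (h₂ : v₂ = 0 → u₂ = 0) :
    (a * u₁ + b * u₂) * Real.log ((a * u₁ + b * u₂) / (a * v₁ + b * v₂)) ≤
      a * (u₁ * Real.log (u₁ / v₁)) + b * (u₂ * Real.log (u₂ / v₂)) := by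
  set u := a * u₁ + b * u₂ with hu
  set v := a * v₁ + b * v₂ with hv
  have hu0 : 0 ≤ u := by positivity
  have hv0 : 0 ≤ v := by positivity
  -- Each pair is compared with the mixed ratio u / v; in the weighted sum the left sides add up to
  -- at least 0.
  have key : ∀ u' v' : ℝ, 0 ≤ u' → 0 ≤ v' → (v' = 0 → u' = 0) → (0 < u' → 0 < u) →
      (0 < v' → 0 < v) → u' - u * v' / v ≤ u' * Real.log (u' / v') - u' * Real.log (u / v) := by
    intro u' v' hu' hv' h hpu hpv
    rcases hu'.eq_or_lt with h0 | h0
    · rw [← h0]; simp; positivity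
    have hv'0 : 0 < v' := hv'.lt_of_ne fun e => h0.ne' (h e.symm)
    have hup := hpu h0
    have hvp := hpv hv'0
    have := sub_le_mul_log_div (a := u') (b := u * v' / v) hu' (by positivity)
      (fun e => absurd e (by positivity))
    have e : u' / (u * v' / v) = (u' / v') / (u / v) := by field_simp
    rw [e, Real.log_div (by positivity) (by positivity), mul_sub] at this
    exact this
  have k₁ := key u₁ v₁ hu₁ hv₁ h₁ (fun h => by positivity) (fun h => by positivity)
  have k₂ := key u₂ v₂ hu₂ hv₂ h₂ (fun h => by positivity) (fun h => by positivity)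
  have k₁' := mul_le_mul_of_nonneg_left k₁ ha.le
  have k₂' := mul_le_mul_of_nonneg_left k₂ hb.le
  have e : a * (u * v₁ / v) + b * (u * v₂ / v) ≤ u := by
    have : a * (u * v₁ / v) + b * (u * v₂ / v) = u * (v / v) := by rw [hv]; ring
    rw [this]
    exact mul_le_of_le_one_right hu0 (div_self_le_one v)
  have e2 : u * Real.log (u / v) = a * (u₁ * Real.log (u / v)) + b * (u₂ * Real.log (u / v)) := by
    rw [hu]; ring
  rw [e2]
  linarith [hu]

namespace Marton

/-! ### Mutual information and its tilted dual -/

section Information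

variable {X Y : Type*} [Fintype Y]

theorem isCompact_channels : IsCompact (channels X Y) := by
  have : channels X Y = Set.pi Set.univ fun _ => stdSimplex ℝ Y := by
    ext V; simp [channels]
  rw [this]
  exact isCompact_univ_pi fun _ => isCompact_stdSimplex ℝ Y

theorem convex_channels : Convex ℝ (channels X Y) := by
  have : channels X Y = Set.pi Set.univ fun _ => stdSimplex ℝ Y := by
    ext V; simp [channels]
  rw [this]
  exact convex_pi fun _ _ => convex_stdSimplex ℝ Y

/-- `∑_y p(y) e^{-ν d(x,y)}`. -/
noncomputable def tiltedSum (d : X → Y → ℝ) (ν : ℝ) (p : Y → ℝ) (x : X) : ℝ :=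
  ∑ y, p y * Real.exp (-ν * d x y)

theorem tiltedSum_pos (d : X → Y → ℝ) (ν : ℝ) {p : Y → ℝ} (hp : p ∈ stdSimplex ℝ Y) (x : X) :
    0 < tiltedSum d ν p x := by
  obtain ⟨y, hy⟩ : ∃ y, p y ≠ 0 := by
    by_contra! h
    have := hp.2
    simp [h] at this
  refine Finset.sum_pos' (fun y _ => mul_nonneg (hp.1 y) (Real.exp_pos _).le)
    ⟨y, Finset.mem_univ y, mul_pos ((hp.1 y).lt_of_ne hy.symm) (Real.exp_pos _)⟩

theorem continuous_tiltedSum (d : X → Y → ℝ) (ν : ℝ) (x : X) :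
    Continuous fun p => tiltedSum d ν p x := by
  unfold tiltedSum; fun_prop

theorem tiltedSum_combo (d : X → Y → ℝ) (ν : ℝ) (x : X) (p p' : Y → ℝ) (a b : ℝ) :
    tiltedSum d ν (a • p + b • p') x = a * tiltedSum d ν p x + b * tiltedSum d ν p' x := by
  simp only [tiltedSum, Finset.mul_sum, ← Finset.sum_add_distrib]
  refine Finset.sum_congr rfl fun y _ => ?_
  simp only [Pi.add_apply, Pi.smul_apply, smul_eq_mul]
  ring

variable [Fintype X]

/-- The output distribution of the channel `V` with input distribution `q`. -/
noncomputable def output (q : X → ℝ) (V : X → Y → ℝ) (y : Y) : ℝ :=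
  ∑ x, q x * V x y

theorem output_nonneg {q : X → ℝ} (hq : q ∈ stdSimplex ℝ X) {V : X → Y → ℝ}
    (hV : V ∈ channels X Y) (y : Y) : 0 ≤ output q V y :=
  Finset.sum_nonneg fun x _ => mul_nonneg (hq.1 x) ((hV x).1 y)

theorem mul_eq_zero_of_output_eq_zero {q : X → ℝ} (hq : q ∈ stdSimplex ℝ X) {V : X → Y → ℝ}
    (hV : V ∈ channels X Y) {y : Y} (h : output q V y = 0) (x : X) : q x * V x y = 0 :=
  (Finset.sum_eq_zero_iff_of_nonneg fun x _ => mul_nonneg (hq.1 x) ((hV x).1 y)).1 h x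
    (Finset.mem_univ x)

theorem output_mem {q : X → ℝ} (hq : q ∈ stdSimplex ℝ X) {V : X → Y → ℝ}
    (hV : V ∈ channels X Y) : output q V ∈ stdSimplex ℝ Y := by
  refine ⟨output_nonneg hq hV, ?_⟩
  simp only [output]
  rw [Finset.sum_comm]
  simp_rw [← Finset.mul_sum, fun x => (hV x).2, mul_one]
  exact hq.2

/-- Mutual information as a difference of entropies, a continuous function of the joint law. -/
theorem mutualInfo_eq_entropies {q : X → ℝ} (hq : q ∈ stdSimplex ℝ X) {V : X → Y → ℝ}
    (hV : V ∈ channels X Y) :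
    mutualInfo q V = (∑ y, Real.negMulLog (∑ x, q x * V x y)) + (∑ x, Real.negMulLog (q x)) -
      ∑ x, ∑ y, Real.negMulLog (q x * V x y) := by
  have h₁ : ∀ x y, q x * V x y * Real.log (V x y / ∑ x', q x' * V x' y) =
      V x y * Real.negMulLog (q x) - Real.negMulLog (q x * V x y) -
        q x * V x y * Real.log (output q V y) := by
    intro x y
    by_cases h : q x * V x y = 0
    · rcases mul_eq_zero.1 h with h | h <;> simp [h]
    have hq0 := left_ne_zero_of_mul h
    have hV0 := right_ne_zero_of_mul h
    have hr : output q V y ≠ 0 := fun e => h (mul_eq_zero_of_output_eq_zero hq hV e x)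
    change _ * Real.log (V x y / output q V y) = _
    rw [Real.log_div hV0 hr, Real.negMulLog_mul]
    simp only [Real.negMulLog]
    ring
  unfold mutualInfo
  simp_rw [h₁, Finset.sum_sub_distrib, ← Finset.sum_mul, fun x => (hV x).2, one_mul]
  rw [Finset.sum_comm (f := fun x y => q x * V x y * Real.log (output q V y))]
  simp_rw [← Finset.sum_mul]
  have : ∀ y, Real.negMulLog (∑ x, q x * V x y) =
      -((∑ x, q x * V x y) * Real.log (output q V y)) := by
    intro y; simp [Real.negMulLog, output]
  simp_rw [this, Finset.sum_neg_distrib]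
  ring

theorem continuousOn_mutualInfo {q : X → ℝ} (hq : q ∈ stdSimplex ℝ X) :
    ContinuousOn (mutualInfo (Y := Y) q) (channels X Y) := by
  refine ContinuousOn.congr (Continuous.continuousOn ?_) fun V hV => mutualInfo_eq_entropies hq hV
  have hn := Real.continuous_negMulLog
  fun_prop

/-- Each summand is u log (u / v) with u = q(x) V(y|x) and v = q(x) times the output probability of
y, both linear in V. -/
theorem convexOn_mutualInfo {q : X → ℝ} (hq : q ∈ stdSimplex ℝ X) :
    ConvexOn ℝ (channels X Y) (mutualInfo (Y := Y) q) := by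
  refine convexOn_iff_forall_pos.2 ⟨convex_channels, fun V hV W hW a b ha hb hab => ?_⟩
  simp only [smul_eq_mul, mutualInfo, Finset.mul_sum, ← Finset.sum_add_distrib]
  refine Finset.sum_le_sum fun x _ => Finset.sum_le_sum fun y _ => ?_
  rcases (hq.1 x).eq_or_lt with h0 | h0
  · simp [← h0]
  have h := mul_log_div_convex (u₁ := q x * V x y) (u₂ := q x * W x y)
    (v₁ := q x * output q V y) (v₂ := q x * output q W y) ha hb
    (mul_nonneg h0.le ((hV x).1 y)) (mul_nonneg h0.le ((hW x).1 y))
    (mul_nonneg h0.le (output_nonneg hq hV y)) (mul_nonneg h0.le (output_nonneg hq hW y))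
    (fun e => mul_eq_zero_of_output_eq_zero hq hV ((mul_eq_zero.1 e).resolve_left h0.ne') x)
    (fun e => mul_eq_zero_of_output_eq_zero hq hW ((mul_eq_zero.1 e).resolve_left h0.ne') x)
  rw [mul_div_mul_left _ _ h0.ne', mul_div_mul_left _ _ h0.ne'] at h
  have e₁ : a * (q x * V x y) + b * (q x * W x y) = q x * (a * V x y + b * W x y) := by ring
  have e₂ : a * (q x * output q V y) + b * (q x * output q W y) =
      q x * (a * output q V y + b * output q W y) := by ring
  have e₃ : (∑ x', q x' * (a • V + b • W) x' y) = a * output q V y + b * output q W y := by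
    simp only [output, Finset.mul_sum, ← Finset.sum_add_distrib]
    refine Finset.sum_congr rfl fun x _ => ?_
    simp only [Pi.add_apply, Pi.smul_apply, smul_eq_mul]
    ring
  rw [e₁, e₂, mul_div_mul_left _ _ h0.ne'] at h
  rw [e₃]
  exact h

/-- `-∑ₓ q(x) log ∑_y p(y) e^{-ν d(x,y)}`. -/
noncomputable def tiltedCost (d : X → Y → ℝ) (ν : ℝ) (q : X → ℝ) (p : Y → ℝ) : ℝ :=
  -∑ x, q x * Real.log (tiltedSum d ν p x)

theorem continuousOn_tiltedCost (d : X → Y → ℝ) (ν : ℝ) (q : X → ℝ) :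
    ContinuousOn (tiltedCost d ν q) (stdSimplex ℝ Y) := by
  refine (continuousOn_finsetSum _ fun x _ => continuousOn_const.mul ?_).neg
  exact (continuous_tiltedSum d ν x).continuousOn.log fun p hp => (tiltedSum_pos d ν hp x).ne'

theorem convexOn_tiltedCost (d : X → Y → ℝ) (ν : ℝ) {q : X → ℝ} (hq : q ∈ stdSimplex ℝ X) :
    ConvexOn ℝ (stdSimplex ℝ Y) (tiltedCost d ν q) := by
  refine ⟨convex_stdSimplex ℝ Y, fun p hp p' hp' a b ha hb hab => ?_⟩
  simp only [tiltedCost, smul_eq_mul, mul_neg, Finset.mul_sum, ← neg_add,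
    ← Finset.sum_add_distrib]
  refine neg_le_neg (Finset.sum_le_sum fun x _ => ?_)
  have := strictConcaveOn_log_Ioi.concaveOn.2 (tiltedSum_pos d ν hp x) (tiltedSum_pos d ν hp' x)
    ha hb hab
  simp only [smul_eq_mul] at this
  rw [tiltedSum_combo]
  have := mul_le_mul_of_nonneg_left this (hq.1 x)
  linarith

/-- The log-sum inequality for V(·|x) against the tilted output law, averaged over x with weights
q(x). -/
theorem tiltedCost_output_le (d : X → Y → ℝ) (ν : ℝ) {q : X → ℝ} (hq : q ∈ stdSimplex ℝ X)
    {V : X → Y → ℝ} (hV : V ∈ channels X Y) :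
    tiltedCost d ν q (output q V) ≤ mutualInfo q V + ν * expDistortion d q V := by
  simp only [tiltedCost, mutualInfo, expDistortion, Finset.mul_sum, ← Finset.sum_add_distrib,
    ← Finset.sum_neg_distrib]
  refine Finset.sum_le_sum fun x _ => ?_
  rcases (hq.1 x).eq_or_lt with h0 | h0
  · simp [← h0]
  have hz : ∀ y, output q V y = 0 → V x y = 0 := fun y h =>
    (mul_eq_zero.1 (mul_eq_zero_of_output_eq_zero hq hV h x)).resolve_left h0.ne'
  have h := neg_log_sum_le (hV x) (b := fun y => output q V y * Real.exp (-ν * d x y))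
    (fun y => mul_nonneg (output_nonneg hq hV y) (Real.exp_pos _).le)
    (fun y e => hz y ((mul_eq_zero.1 e).resolve_right (Real.exp_pos _).ne'))
  have h' := mul_le_mul_of_nonneg_left h h0.le
  rw [Finset.mul_sum] at h'
  rw [← mul_neg]
  refine h'.trans (le_of_eq (Finset.sum_congr rfl fun y _ => ?_))
  by_cases hv : V x y = 0
  · simp [hv]
  have hr : output q V y ≠ 0 := fun e => hv (hz y e)
  change _ = q x * V x y * Real.log (V x y / output q V y) + _
  rw [← div_div, Real.log_div (div_ne_zero hv hr) (Real.exp_pos _).ne', Real.log_exp]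
  ring

/-- The gap between the two sides is the relative entropy of the output law from p. -/
theorem mutualInfo_le_of_output {q : X → ℝ} (hq : q ∈ stdSimplex ℝ X) {V : X → Y → ℝ}
    (hV : V ∈ channels X Y) {p : Y → ℝ} (hp : p ∈ stdSimplex ℝ Y)
    (hpV : ∀ x y, p y = 0 → V x y = 0) :
    mutualInfo q V ≤ ∑ x, ∑ y, q x * V x y * Real.log (V x y / p y) := by
  have hpr : ∀ y, p y = 0 → output q V y = 0 := fun y h => by
    simp [output, fun x => hpV x y h]
  have h := neg_log_sum_le (output_mem hq hV) hp.1 hpr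
  rw [hp.2, Real.log_one, neg_zero] at h
  have key : (∑ x, ∑ y, q x * V x y * Real.log (V x y / p y)) - mutualInfo q V =
      ∑ y, output q V y * Real.log (output q V y / p y) := by
    simp only [mutualInfo, ← Finset.sum_sub_distrib]
    rw [Finset.sum_comm]
    refine Finset.sum_congr rfl fun y _ => ?_
    conv_rhs => rw [output, Finset.sum_mul]
    refine Finset.sum_congr rfl fun x _ => ?_
    by_cases h : q x * V x y = 0
    · simp [h]
    have hv := right_ne_zero_of_mul h
    have hr : output q V y ≠ 0 := fun e => h (mul_eq_zero_of_output_eq_zero hq hV e x)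
    have hp0 : p y ≠ 0 := fun e => hr (hpr y e)
    change _ - _ * Real.log (V x y / output q V y) = _ * Real.log (output q V y / p y)
    rw [Real.log_div hv hp0, Real.log_div hv hr, Real.log_div hr hp0]
    ring
  linarith

/-- The Gibbs channel V(y|x) ∝ p(y) exp(-ν d(x,y)) makes the log-sum inequality an equality for
every x. -/
theorem exists_channel_le_tiltedCost (d : X → Y → ℝ) (ν : ℝ) {q : X → ℝ}
    (hq : q ∈ stdSimplex ℝ X) {p : Y → ℝ} (hp : p ∈ stdSimplex ℝ Y) :
    ∃ V ∈ channels X Y, mutualInfo q V + ν * expDistortion d q V ≤ tiltedCost d ν q p := by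
  have hφ := tiltedSum_pos d ν hp
  set V : X → Y → ℝ := fun x y => p y * Real.exp (-ν * d x y) / tiltedSum d ν p x with hVdef
  have hV : V ∈ channels X Y := fun x =>
    ⟨fun y => div_nonneg (mul_nonneg (hp.1 y) (Real.exp_pos _).le) (hφ x).le, by
      simp only [hVdef]
      rw [← Finset.sum_div]
      exact div_self (hφ x).ne'⟩
  refine ⟨V, hV, ?_⟩
  have h := mutualInfo_le_of_output hq hV hp fun x y e => by simp [hVdef, e]
  have : (∑ x, ∑ y, q x * V x y * Real.log (V x y / p y)) + ν * expDistortion d q V =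
      tiltedCost d ν q p := by
    simp only [tiltedCost, expDistortion, Finset.mul_sum, ← Finset.sum_add_distrib,
      ← Finset.sum_neg_distrib]
    refine Finset.sum_congr rfl fun x _ => ?_
    have : ∀ y, q x * V x y * Real.log (V x y / p y) + ν * (q x * V x y * d x y) =
        -(q x * Real.log (tiltedSum d ν p x)) * V x y := by
      intro y
      by_cases hv : V x y = 0
      · simp [hv]
      have hp0 : p y ≠ 0 := fun e => hv (by simp [hVdef, e])
      have e : V x y / p y = Real.exp (-ν * d x y) / tiltedSum d ν p x := by
        simp only [hVdef]; field_simp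
      rw [e, Real.log_div (Real.exp_pos _).ne' (hφ x).ne', Real.log_exp]
      ring
    simp_rw [this, ← Finset.mul_sum, (hV x).2, mul_one]
  linarith

end Information

/-! ### Duality and semicontinuity of the rate-distortion function -/

section RateDistortion

variable {X Y : Type*} [Fintype Y]

theorem exists_zero_distortion_channel {d : X → Y → ℝ} (hd0 : ∀ x, ∃ y, d x y = 0) :
    ∃ W ∈ channels X Y, ∀ x y, W x y * d x y = 0 := by
  classical
  choose g hg using hd0
  refine ⟨fun x => Pi.single (g x) 1, fun x => single_mem_stdSimplex ℝ (g x), fun x y => ?_⟩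
  by_cases h : y = g x
  · subst h; simp [hg]
  · simp [Pi.single_eq_of_ne h]

variable [Fintype X]

theorem continuous_expDistortion (d : X → Y → ℝ) (q : X → ℝ) :
    Continuous (expDistortion d q) := by
  unfold expDistortion; fun_prop

theorem expDistortion_combo (d : X → Y → ℝ) (q : X → ℝ) (V W : X → Y → ℝ) (a b : ℝ) :
    expDistortion d q (a • V + b • W) = a * expDistortion d q V + b * expDistortion d q W := by
  simp only [expDistortion, Finset.mul_sum, ← Finset.sum_add_distrib]
  refine Finset.sum_congr rfl fun x _ => Finset.sum_congr rfl fun y _ => ?_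
  simp only [Pi.add_apply, Pi.smul_apply, smul_eq_mul]
  ring

theorem exists_rateDistortion_eq {d : X → Y → ℝ} (hd0 : ∀ x, ∃ y, d x y = 0) {Δ : ℝ}
    (hΔ : 0 ≤ Δ) {q : X → ℝ} (hq : q ∈ stdSimplex ℝ X) :
    ∃ V ∈ channels X Y, expDistortion d q V ≤ Δ ∧ mutualInfo q V = rateDistortion d Δ q ∧
      ∀ W ∈ channels X Y, expDistortion d q W ≤ Δ → rateDistortion d Δ q ≤ mutualInfo q W := by
  obtain ⟨W, hW, hWd⟩ := exists_zero_distortion_channel hd0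
  have hk : IsCompact {V | V ∈ channels X Y ∧ expDistortion d q V ≤ Δ} :=
    isCompact_channels.inter_right (isClosed_le (continuous_expDistortion d q) continuous_const)
  obtain ⟨V, hV, hmin⟩ := hk.exists_isMinOn ⟨W, hW, by simpa [expDistortion, mul_assoc, hWd]⟩
    ((continuousOn_mutualInfo hq).mono fun V hV => hV.1)
  have hleast : IsLeast (rateSet d Δ q) (mutualInfo q V) :=
    ⟨⟨V, hV, rfl⟩, by rintro _ ⟨U, hU, rfl⟩; exact hmin hU⟩
  have e : rateDistortion d Δ q = mutualInfo q V := hleast.csInf_eq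
  exact ⟨V, hV.1, hV.2, e.symm, fun U hU hUd => e ▸ hmin ⟨hU, hUd⟩⟩

/-- Strong Lagrange duality for the rate-distortion function. -/
theorem exists_multiplier_of_lt_rateDistortion {d : X → Y → ℝ} (hd0 : ∀ x, ∃ y, d x y = 0) {Δ : ℝ}
    (hΔ : 0 ≤ Δ) {q : X → ℝ} (hq : q ∈ stdSimplex ℝ X) {t : ℝ} (ht : t < rateDistortion d Δ q) :
    ∃ ν, 0 ≤ ν ∧ ∀ p ∈ stdSimplex ℝ Y, t < -ν * Δ + tiltedCost d ν q p := by
  obtain ⟨V₀, hV₀, -, -, hR⟩ := exists_rateDistortion_eq hd0 hΔ hq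
  obtain ⟨ν, hν, h⟩ := exists_forall_lt_of_minimax (A := channels X Y) (B := Set.Ici (0 : ℝ))
    (f := fun V ν => mutualInfo q V + ν * (expDistortion d q V - Δ)) (t := t)
    ⟨V₀, hV₀⟩ convex_channels isCompact_channels (convex_Ici 0)
    (fun ν _ => (continuousOn_mutualInfo hq).add
      (((continuous_expDistortion d q).sub continuous_const).const_smul ν).continuousOn)
    (fun ν hν => (convexOn_mutualInfo hq).add ⟨convex_channels, fun V _ W _ a b _ _ hab => by
      simp only [expDistortion_combo, smul_eq_mul]
      refine le_of_eq ?_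
      linear_combination (ν * Δ) * hab⟩)
    (fun V _ => by fun_prop)
    (fun V _ => ⟨convex_Ici 0, fun ν _ ν' _ a b _ _ hab => by
      simp only [smul_eq_mul]
      refine le_of_eq ?_
      linear_combination (mutualInfo q V) * hab⟩)
    (fun V hV => by
      -- A feasible V needs no penalty, as its information already exceeds t. For an infeasible V, ν
      -- is chosen to make the penalty |t| + |I(q,V)| + 1.
      by_cases h : expDistortion d q V ≤ Δ
      · exact ⟨0, Set.self_mem_Ici, by simpa using ht.trans_le (hR V hV h)⟩
      · have hpos : 0 < expDistortion d q V - Δ := by linarith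
        refine ⟨(|t| + |mutualInfo q V| + 1) / (expDistortion d q V - Δ), by
          show (0 : ℝ) ≤ _; positivity, ?_⟩
        rw [div_mul_cancel₀ _ hpos.ne']
        linarith [le_abs_self t, neg_abs_le (mutualInfo q V)])
  refine ⟨ν, hν, fun p hp => ?_⟩
  obtain ⟨V, hV, hle⟩ := exists_channel_le_tiltedCost d ν hq hp
  have := h V hV
  linarith

/-- Weak duality: p is the output law of the optimal channel. -/
theorem exists_tiltedCost_le_rateDistortion {d : X → Y → ℝ} (hd0 : ∀ x, ∃ y, d x y = 0) {Δ : ℝ}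
    (hΔ : 0 ≤ Δ) {q : X → ℝ} (hq : q ∈ stdSimplex ℝ X) {ν : ℝ} (hν : 0 ≤ ν) :
    ∃ p ∈ stdSimplex ℝ Y, -ν * Δ + tiltedCost d ν q p ≤ rateDistortion d Δ q := by
  obtain ⟨V, hV, hVd, hVR, -⟩ := exists_rateDistortion_eq hd0 hΔ hq
  refine ⟨_, output_mem hq hV, ?_⟩
  have h₁ := tiltedCost_output_le d ν hq hV
  have h₂ := mul_le_mul_of_nonneg_left hVd hν
  linarith

/-- Near `q₀`, the rate-distortion function is dominated by a continuous function that agrees with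
it at `q₀`: transport the optimal channel of `q₀`, sending the excess mass without distortion. -/
theorem upperSemicontinuousOn_rateDistortion {d : X → Y → ℝ} (hd : ∀ x y, 0 ≤ d x y)
    (hd0 : ∀ x, ∃ y, d x y = 0) {Δ : ℝ} (hΔ : 0 ≤ Δ) :
    UpperSemicontinuousOn (rateDistortion d Δ) (stdSimplex ℝ X) := by
  intro q₀ hq₀
  obtain ⟨V₀, hV₀, hVd, hVR, -⟩ := exists_rateDistortion_eq hd0 hΔ hq₀
  obtain ⟨W, hW, hWd⟩ := exists_zero_distortion_channel hd0
  -- The joint law is written without dividing by q(x), so that f is continuous also where q(x)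
  -- vanishes.
  set J : (X → ℝ) → X → Y → ℝ := fun q x y =>
    min (q x) (q₀ x) * V₀ x y + (q x - min (q x) (q₀ x)) * W x y with hJ
  set f : (X → ℝ) → ℝ := fun q => (∑ y, Real.negMulLog (∑ x, J q x y)) +
    (∑ x, Real.negMulLog (q x)) - ∑ x, ∑ y, Real.negMulLog (J q x y) with hf
  have hfc : Continuous f := by
    have hn := Real.continuous_negMulLog
    simp only [hf, hJ]
    fun_prop
  have hle : ∀ q ∈ stdSimplex ℝ X, rateDistortion d Δ q ≤ f q := by
    intro q hq
    obtain ⟨-, -, -, -, hR⟩ := exists_rateDistortion_eq hd0 hΔ hq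
    set s : X → ℝ := fun x => min (q x) (q₀ x) / q x with hs
    have hmin : ∀ x, 0 ≤ min (q x) (q₀ x) := fun x => le_min (hq.1 x) (hq₀.1 x)
    have hs0 : ∀ x, 0 ≤ s x := fun x => div_nonneg (hmin x) (hq.1 x)
    have hs1 : ∀ x, s x ≤ 1 := fun x => div_le_one_of_le₀ (min_le_left _ _) (hq.1 x)
    have hqs : ∀ x, q x * s x = min (q x) (q₀ x) := by
      intro x
      rcases (hq.1 x).eq_or_lt with h | h
      · rw [← h, zero_mul, min_eq_left (hq₀.1 x)]
      · exact mul_div_cancel₀ _ h.ne'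
    set V : X → Y → ℝ := fun x => s x • V₀ x + (1 - s x) • W x with hVdef
    have hV : V ∈ channels X Y := fun x => convex_stdSimplex ℝ Y (hV₀ x) (hW x) (hs0 x)
      (sub_nonneg.2 (hs1 x)) (by ring)
    have hVJ : ∀ x y, q x * V x y = J q x y := by
      intro x y
      simp only [hVdef, hJ, Pi.add_apply, Pi.smul_apply, smul_eq_mul, ← hqs]
      ring
    have hfq : mutualInfo q V = f q := by
      rw [mutualInfo_eq_entropies hq hV]
      simp only [hVJ, hf]
    rw [← hfq]
    refine hR V hV (le_trans ?_ hVd)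
    refine Finset.sum_le_sum fun x _ => Finset.sum_le_sum fun y _ => ?_
    -- Excess mass costs nothing, and the mass kept on V₀ is at most q₀(x), so the distortion does
    -- not exceed that of V₀ under q₀.
    have e : q x * V x y * d x y = min (q x) (q₀ x) * (V₀ x y * d x y) := by
      rw [hVJ]; simp only [hJ]
      linear_combination (q x - min (q x) (q₀ x)) * hWd x y
    rw [e, mul_assoc]
    exact mul_le_mul_of_nonneg_right (min_le_right _ _) (mul_nonneg ((hV₀ x).1 y) (hd x y))
  have hf₀ : f q₀ = rateDistortion d Δ q₀ := by
    rw [← hVR, mutualInfo_eq_entropies hq₀ hV₀]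
    simp [hf, hJ]
  intro c hc
  rw [← hf₀] at hc
  filter_upwards [hfc.continuousWithinAt.eventually_lt_const hc, self_mem_nhdsWithin] with q h₁ h₂
  exact (hle q h₂).trans_lt h₁

end RateDistortion

/-! ### Relative entropy on its finite domain -/

section RelativeEntropy

variable {X : Type*} [Fintype X]

/-- Probability vectors that are absolutely continuous with respect to `P`. -/
def acSimplex (P : X → ℝ) : Set (X → ℝ) :=
  {q | q ∈ stdSimplex ℝ X ∧ ∀ x, P x = 0 → q x = 0}

/-- The finite part of the relative entropy. -/
noncomputable def klSum (q P : X → ℝ) : ℝ :=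
  ∑ x, q x * Real.log (q x / P x)

theorem mem_acSimplex_iff_relEntropy_le {q P : X → ℝ} {E : ℝ} :
    (q ∈ stdSimplex ℝ X ∧ relEntropy q P ≤ (E : EReal)) ↔ q ∈ acSimplex P ∧ klSum q P ≤ E := by
  unfold relEntropy acSimplex klSum
  split_ifs with h
  · rw [EReal.coe_le_coe_iff]
    exact ⟨fun H => ⟨⟨H.1, h⟩, H.2⟩, fun H => ⟨H.1.1, H.2⟩⟩
  · simp only [top_le_iff, EReal.coe_ne_top, and_false, false_iff]
    exact fun H => h H.1.2

theorem isCompact_acSimplex (P : X → ℝ) : IsCompact (acSimplex P) := by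
  refine (isCompact_stdSimplex ℝ X).inter_right ?_
  have : {q : X → ℝ | ∀ x, P x = 0 → q x = 0} = ⋂ x, ⋂ (_ : P x = 0), {q | q x = 0} := by
    ext q; simp
  change IsClosed {q : X → ℝ | ∀ x, P x = 0 → q x = 0}
  rw [this]
  exact isClosed_iInter fun x => isClosed_iInter fun _ =>
    isClosed_eq (continuous_apply x) continuous_const

theorem convex_acSimplex (P : X → ℝ) : Convex ℝ (acSimplex P) := fun q hq q' hq' a b ha hb hab =>
  ⟨convex_stdSimplex ℝ X hq.1 hq'.1 ha hb hab, fun x hx => by simp [hq.2 x hx, hq'.2 x hx]⟩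

theorem klSum_self (P : X → ℝ) : klSum P P = 0 :=
  Finset.sum_eq_zero fun x _ => by
    by_cases h : P x = 0
    · simp [h]
    · simp [div_self h]

theorem continuous_klSum (P : X → ℝ) : Continuous fun q => klSum q P := by
  refine continuous_finsetSum _ fun x _ => ?_
  -- Where P(x) = 0 the summand is identically 0, by the conventions for division and logarithm at
  -- 0; hence continuity on the whole space.
  by_cases h : P x = 0
  · simpa [h] using continuous_const
  have e : (fun q : X → ℝ => q x * Real.log (q x / P x)) =
      fun q => q x * Real.log (q x) - q x * Real.log (P x) := by
    ext q
    by_cases hq : q x = 0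
    · simp [hq]
    · rw [Real.log_div hq h]; ring
  rw [e]
  exact (Real.continuous_mul_log.comp (continuous_apply x)).sub
    ((continuous_apply x).mul continuous_const)

theorem convexOn_klSum {P : X → ℝ} (hP : ∀ x, 0 ≤ P x) :
    ConvexOn ℝ (acSimplex P) fun q => klSum q P := by
  refine convexOn_iff_forall_pos.2 ⟨convex_acSimplex P, fun q hq q' hq' a b ha hb hab => ?_⟩
  simp only [klSum, smul_eq_mul, Finset.mul_sum, ← Finset.sum_add_distrib]
  refine Finset.sum_le_sum fun x _ => ?_
  have h := mul_log_div_convex ha hb (hq.1.1 x) (hq'.1.1 x) (hP x) (hP x) (hq.2 x) (hq'.2 x)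
  rwa [← add_mul, hab, one_mul] at h

end RelativeEntropy

theorem nonempty_of_mem_stdSimplex {ι : Type*} [Fintype ι] {p : ι → ℝ} (hp : p ∈ stdSimplex ℝ ι) :
    Nonempty ι := by
  by_contra h
  rw [not_nonempty_iff] at h
  simpa using hp.2

/-! ### The Gibbs variational principle for G -/

section GFunction

variable {X Y : Type*} [Fintype X] [Fintype Y]

/-- Identifies the log-sum expression with reference weights P(x) S(x)^(-1/μ), S = `tiltedSum d ν
p`, as the negated Lagrangian. -/
theorem mul_sum_mul_log_div_tilted (d : X → Y → ℝ) {μ : ℝ} (hμ : μ ≠ 0) (ν : ℝ) {P q : X → ℝ}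
    (hq : q ∈ acSimplex P) {p : Y → ℝ} (hp : p ∈ stdSimplex ℝ Y) :
    μ * ∑ x, q x * Real.log (q x / (P x * tiltedSum d ν p x ^ (-1 / μ))) =
      μ * klSum q P - tiltedCost d ν q p := by
  simp only [klSum, tiltedCost, sub_neg_eq_add, Finset.mul_sum, ← Finset.sum_add_distrib]
  refine Finset.sum_congr rfl fun x _ => ?_
  by_cases h : q x = 0
  · simp [h]
  have hPx : P x ≠ 0 := fun e => h (hq.2 x e)
  have hφ := tiltedSum_pos d ν hp x
  rw [← div_div, Real.log_div (div_ne_zero h hPx) (Real.rpow_pos_of_pos hφ _).ne',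
    Real.log_rpow hφ]
  field_simp
  ring

/-- For μ > 0 this is the log-sum inequality. For μ = 0 the entropy penalty disappears and an
average of logarithms is at least the smallest one, so q may leave the support of P; hence the
conditional form of `hac`. -/
theorem lagrangian_le_G (d : X → Y → ℝ) {μ : ℝ} (hμ : 0 ≤ μ) (ν : ℝ) {P q : X → ℝ}
    (hP : P ∈ stdSimplex ℝ X) (hq : q ∈ stdSimplex ℝ X) (hac : μ ≠ 0 → q ∈ acSimplex P)
    {p : Y → ℝ} (hp : p ∈ stdSimplex ℝ Y) :
    tiltedCost d ν q p - μ * klSum q P ≤ G d μ ν P p := by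
  have hφ := tiltedSum_pos d ν hp
  unfold G
  split_ifs with h0
  · change _ ≤ -Real.log (⨅ x, tiltedSum d ν p x)
    rw [h0, zero_mul, sub_zero, tiltedCost, neg_le_neg_iff]
    have hX := nonempty_of_mem_stdSimplex hq
    obtain ⟨x₀, hx₀⟩ := exists_eq_ciInf_of_finite (f := tiltedSum d ν p)
    rw [← hx₀, ← one_mul (Real.log _), ← hq.2, Finset.sum_mul]
    refine Finset.sum_le_sum fun x _ => mul_le_mul_of_nonneg_left ?_ (hq.1 x)
    exact Real.log_le_log (hφ x₀) (hx₀ ▸ ciInf_le (Set.finite_range _).bddBelow x)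
  · have h := neg_log_sum_le hq (b := fun x => P x * tiltedSum d ν p x ^ (-1 / μ))
      (fun x => mul_nonneg (hP.1 x) (Real.rpow_pos_of_pos (hφ x) _).le)
      (fun x e => (hac h0).2 x ((mul_eq_zero.1 e).resolve_right (Real.rpow_pos_of_pos (hφ x) _).ne'))
    have h' := mul_le_mul_of_nonneg_left h hμ
    rw [mul_sum_mul_log_div_tilted d h0 ν (hac h0) hp] at h'
    change _ ≤ μ * Real.log (∑ x, P x * tiltedSum d ν p x ^ (-1 / μ))
    linarith

/-- The maximizer is a point mass at a minimum of the tilted sum if μ = 0, and the tilted law q ∝ P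
S^(-1/μ) otherwise. -/
theorem exists_lagrangian_eq_G (d : X → Y → ℝ) (μ ν : ℝ) {P : X → ℝ}
    (hP : P ∈ stdSimplex ℝ X) {p : Y → ℝ} (hp : p ∈ stdSimplex ℝ Y) :
    ∃ q ∈ stdSimplex ℝ X, (μ ≠ 0 → q ∈ acSimplex P) ∧
      tiltedCost d ν q p - μ * klSum q P = G d μ ν P p := by
  classical
  have hφ := tiltedSum_pos d ν hp
  unfold G
  split_ifs with h0
  · have hX := nonempty_of_mem_stdSimplex hP
    obtain ⟨x₀, hx₀⟩ := exists_eq_ciInf_of_finite (f := tiltedSum d ν p)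
    refine ⟨Pi.single x₀ 1, single_mem_stdSimplex ℝ x₀, fun h => absurd h0 h, ?_⟩
    change _ = -Real.log (⨅ x, tiltedSum d ν p x)
    rw [h0, zero_mul, sub_zero, tiltedCost, ← hx₀]
    simp [Pi.single_apply]
  · set b : X → ℝ := fun x => P x * tiltedSum d ν p x ^ (-1 / μ) with hb
    have hb0 : ∀ x, 0 ≤ b x := fun x => mul_nonneg (hP.1 x) (Real.rpow_pos_of_pos (hφ x) _).le
    have hS : 0 < ∑ x, b x := by
      obtain ⟨x, hx⟩ : ∃ x, P x ≠ 0 := by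
        by_contra! h
        have := hP.2
        simp [h] at this
      exact Finset.sum_pos' (fun x _ => hb0 x) ⟨x, Finset.mem_univ x,
        mul_pos ((hP.1 x).lt_of_ne hx.symm) (Real.rpow_pos_of_pos (hφ x) _)⟩
    set q : X → ℝ := fun x => b x / ∑ x, b x with hqdef
    have hq : q ∈ acSimplex P :=
      ⟨⟨fun x => div_nonneg (hb0 x) hS.le, by
        simp only [hqdef]; rw [← Finset.sum_div, div_self hS.ne']⟩,
        fun x e => by simp [hqdef, hb, e]⟩
    refine ⟨q, hq.1, fun _ => hq, ?_⟩
    have h := mul_sum_mul_log_div_tilted d h0 ν hq hp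
    have e : ∀ x, q x * Real.log (q x / b x) = q x * -Real.log (∑ x, b x) := by
      intro x
      by_cases hx : b x = 0
      · simp [hqdef, hx]
      · rw [← Real.log_inv]
        congr 2
        simp only [hqdef]
        field_simp
    change μ * ∑ x, q x * Real.log (q x / b x) = _ at h
    simp_rw [e] at h
    rw [← Finset.sum_mul, hq.1.2] at h
    change _ = μ * Real.log (∑ x, b x)
    linarith

/-- G is a pointwise maximum over q of functions convex in p; the proof uses the q that is optimal
at the mixture. -/
theorem convexOn_G (d : X → Y → ℝ) {μ : ℝ} (hμ : 0 ≤ μ) (ν : ℝ) {P : X → ℝ}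
    (hP : P ∈ stdSimplex ℝ X) : ConvexOn ℝ (stdSimplex ℝ Y) (G d μ ν P) := by
  refine ⟨convex_stdSimplex ℝ Y, fun p hp p' hp' a b ha hb hab => ?_⟩
  obtain ⟨q, hq, hac, e⟩ :=
    exists_lagrangian_eq_G d μ ν hP (convex_stdSimplex ℝ Y hp hp' ha hb hab)
  have h := (convexOn_tiltedCost d ν hq).2 hp hp' ha hb hab
  have h₁ := mul_le_mul_of_nonneg_left (lagrangian_le_G d hμ ν hP hq hac hp) ha
  have h₂ := mul_le_mul_of_nonneg_left (lagrangian_le_G d hμ ν hP hq hac hp') hb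
  simp only [smul_eq_mul] at h ⊢
  rw [← e]
  linear_combination h + h₁ + h₂ + (μ * klSum q P) * hab

/-- The q that is optimal at p₀ gives a continuous minorant touching G there. This treats μ = 0 and
μ > 0 alike. -/
theorem lowerSemicontinuousOn_G (d : X → Y → ℝ) {μ : ℝ} (hμ : 0 ≤ μ) (ν : ℝ) {P : X → ℝ}
    (hP : P ∈ stdSimplex ℝ X) : LowerSemicontinuousOn (G d μ ν P) (stdSimplex ℝ Y) := by
  intro p₀ hp₀ c hc
  obtain ⟨q, hq, hac, e⟩ := exists_lagrangian_eq_G d μ ν hP hp₀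
  rw [← e] at hc
  filter_upwards [((continuousOn_tiltedCost d ν q).sub continuousOn_const p₀ hp₀).eventually_const_lt
    hc, self_mem_nhdsWithin] with p h₁ h₂
  exact h₁.trans_le (lagrangian_le_G d hμ ν hP hq hac h₂)

theorem isLeast_minG [Nonempty Y] (d : X → Y → ℝ) {μ : ℝ} (hμ : 0 ≤ μ) (ν : ℝ) {P : X → ℝ}
    (hP : P ∈ stdSimplex ℝ X) : IsLeast (G d μ ν P '' stdSimplex ℝ Y) (minG d μ ν P) := by
  classical
  obtain ⟨p, hp, hmin⟩ := (lowerSemicontinuousOn_G d hμ ν hP).exists_isMinOn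
    ⟨_, single_mem_stdSimplex ℝ (Classical.arbitrary Y)⟩ (isCompact_stdSimplex ℝ Y)
  have h : IsLeast (G d μ ν P '' stdSimplex ℝ Y) (G d μ ν P p) :=
    ⟨⟨p, hp, rfl⟩, by rintro _ ⟨p', hp', rfl⟩; exact hmin hp'⟩
  have e : minG d μ ν P = G d μ ν P p := h.csInf_eq
  rwa [e]

end GFunction

/-! ### Minimax exchange and the parametric formula -/

section Exponent

variable {X Y : Type*} [Fintype X] [Fintype Y]

theorem isGreatest_invMarton {d : X → Y → ℝ} (hd : ∀ x y, 0 ≤ d x y) (hd0 : ∀ x, ∃ y, d x y = 0)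
    {P : X → ℝ} (hP : P ∈ stdSimplex ℝ X) {E Δ : ℝ} (hE : 0 ≤ E) (hΔ : 0 ≤ Δ) :
    IsGreatest (invMartonSet d E Δ P) (invMarton d E Δ P) := by
  have hS : {q | q ∈ stdSimplex ℝ X ∧ relEntropy q P ≤ (E : EReal)} =
      acSimplex P ∩ {q | klSum q P ≤ E} := Set.ext fun q => mem_acSimplex_iff_relEntropy_le
  have hk : IsCompact (acSimplex P ∩ {q | klSum q P ≤ E}) :=
    (isCompact_acSimplex P).inter_right (isClosed_le (continuous_klSum P) continuous_const)
  obtain ⟨q, hq, hmax⟩ := UpperSemicontinuousOn.exists_isMaxOn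
    (s := acSimplex P ∩ {q | klSum q P ≤ E})
    ⟨P, ⟨hP, fun _ h => h⟩, (klSum_self P).trans_le hE⟩ hk
    ((upperSemicontinuousOn_rateDistortion hd hd0 hΔ).mono fun q hq => hq.1.1)
  have h : IsGreatest (invMartonSet d E Δ P) (rateDistortion d Δ q) := by
    unfold invMartonSet
    rw [hS]
    exact ⟨⟨q, hq, rfl⟩, by rintro _ ⟨q', hq', rfl⟩; exact hmax hq'⟩
  have e : invMarton d E Δ P = rateDistortion d Δ q := h.csSup_eq
  rwa [e]

/-- Minimax step: if every distribution in the relative entropy ball has small cost for some output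
law, then one multiplier and one output law serve for all distributions. -/
theorem exists_G_lt (d : X → Y → ℝ) (ν : ℝ) {P : X → ℝ} (hP : P ∈ stdSimplex ℝ X) (E : ℝ)
    {t : ℝ} (hne : (stdSimplex ℝ Y).Nonempty)
    (h : ∀ q ∈ acSimplex P, klSum q P ≤ E → ∃ p ∈ stdSimplex ℝ Y, tiltedCost d ν q p < t) :
    ∃ μ, 0 < μ ∧ ∃ p ∈ stdSimplex ℝ Y, μ * E + G d μ ν P p < t := by
  -- The payoff is the negated Lagrangian, so the compact variable q minimizes. It is jointly
  -- concave in (p, μ) because p and μ occur in separate summands. Taking μ > 0 keeps the later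
  -- maximizer of the Lagrangian inside `acSimplex P`.
  obtain ⟨⟨p, μ⟩, ⟨hp, hμ⟩, hpμ⟩ := exists_forall_lt_of_minimax (A := acSimplex P)
    (B := stdSimplex ℝ Y ×ˢ Set.Ioi (0 : ℝ))
    (f := fun q z => -tiltedCost d ν q z.1 + z.2 * (klSum q P - E)) (t := -t)
    ⟨P, hP, fun _ h => h⟩ (convex_acSimplex P) (isCompact_acSimplex P)
    ((convex_stdSimplex ℝ Y).prod (convex_Ioi 0))
    (fun z _ => by
      have := continuous_klSum P
      unfold tiltedCost
      fun_prop)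
    (fun z hz => by
      refine ConvexOn.add ⟨convex_acSimplex P, fun q _ q' _ a b _ _ _ => le_of_eq ?_⟩
        (((convexOn_klSum hP.1).add (convexOn_const (-E) (convex_acSimplex P))).smul
          (le_of_lt hz.2))
      simp only [tiltedCost, neg_neg, smul_eq_mul, Finset.mul_sum, ← Finset.sum_add_distrib]
      refine Finset.sum_congr rfl fun x _ => ?_
      simp only [Pi.add_apply, Pi.smul_apply, smul_eq_mul]
      ring)
    (fun q hq => by
      refine ContinuousOn.add (ContinuousOn.neg ?_) (by fun_prop)
      exact (continuousOn_tiltedCost d ν q).comp continuousOn_fst fun z hz => hz.1)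
    (fun q hq => by
      refine ⟨(convex_stdSimplex ℝ Y).prod (convex_Ioi 0), ?_⟩
      intro z hz z' hz' a b ha hb hab
      have := (convexOn_tiltedCost d ν hq.1).2 hz.1 hz'.1 ha hb hab
      simp only [smul_eq_mul, Prod.fst_add, Prod.snd_add, Prod.smul_fst, Prod.smul_snd] at this ⊢
      linarith)
    (fun q hq => by
      by_cases hE : klSum q P ≤ E
      · obtain ⟨p, hp, hlt⟩ := h q hq hE
        -- The added 1 avoids division by zero when q is on the boundary of the ball; this μ is
        -- positive and μ(E - D(q‖P)) stays below the slack t - F(q,p).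
        have hpos : 0 < E - klSum q P + 1 := by linarith
        refine ⟨⟨p, (t - tiltedCost d ν q p) / (E - klSum q P + 1)⟩,
          ⟨hp, div_pos (by linarith) hpos⟩, ?_⟩
        have : (t - tiltedCost d ν q p) / (E - klSum q P + 1) * (klSum q P - E) =
            -(t - tiltedCost d ν q p) + (t - tiltedCost d ν q p) / (E - klSum q P + 1) := by
          field_simp
          ring
        have h' : 0 < (t - tiltedCost d ν q p) / (E - klSum q P + 1) :=
          div_pos (by linarith) hpos
        simp only [this]
        linarith
      · obtain ⟨p, hp⟩ := hne
        -- Outside the ball any p will do: μ is large enough that the entropy penalty outweighs both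
        -- t and F(q,p).
        have hpos : 0 < klSum q P - E := by linarith
        refine ⟨⟨p, (|t| + |tiltedCost d ν q p| + 1) / (klSum q P - E)⟩,
          ⟨hp, by show (0 : ℝ) < _; positivity⟩, ?_⟩
        simp only [div_mul_cancel₀ _ hpos.ne']
        linarith [neg_abs_le t, le_abs_self (tiltedCost d ν q p)])
  have hμ : 0 < μ := hμ
  refine ⟨μ, hμ, p, hp, ?_⟩
  -- The uniform bound is evaluated at the q that attains G.
  obtain ⟨q, -, hac, e⟩ := exists_lagrangian_eq_G d μ ν hP hp
  have := hpμ q (hac hμ.ne')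
  rw [← e]
  linarith

theorem invMarton_eq_iSup_iInf {d : X → Y → ℝ} (hd : ∀ x y, 0 ≤ d x y)
    (hd0 : ∀ x, ∃ y, d x y = 0) {P : X → ℝ} (hP : P ∈ stdSimplex ℝ X) {E Δ : ℝ} (hE : 0 ≤ E)
    (hΔ : 0 ≤ Δ) :
    (invMarton d E Δ P : EReal) = ⨆ (ν : ℝ) (_ : 0 ≤ ν), ⨅ (μ : ℝ) (_ : 0 ≤ μ),
      ((-ν * Δ + μ * E + minG d μ ν P : ℝ) : EReal) := by
  obtain ⟨⟨q₀, hq₀, hq₀R⟩, hub⟩ := isGreatest_invMarton hd hd0 hP hE hΔ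
  obtain ⟨hac₀, hD₀⟩ := mem_acSimplex_iff_relEntropy_le.1 hq₀
  obtain ⟨V, hV, -⟩ := exists_zero_distortion_channel hd0
  have hne : (stdSimplex ℝ Y).Nonempty := ⟨_, output_mem hP hV⟩
  have hY := nonempty_of_mem_stdSimplex hne.some_mem
  apply le_antisymm
  -- The multiplier ν comes from the maximizing q₀ alone; testing G at q₀ then bounds all μ at once.
  · refine EReal.ge_of_forall_gt_iff_ge.1 fun t ht => ?_
    rw [EReal.coe_lt_coe_iff, ← hq₀R] at ht
    obtain ⟨ν, hν, h⟩ := exists_multiplier_of_lt_rateDistortion hd0 hΔ hac₀.1 ht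
    refine le_iSup₂_of_le ν hν (le_iInf₂ fun μ hμ => EReal.coe_le_coe_iff.2 ?_)
    obtain ⟨p, hp, e⟩ := (isLeast_minG d hμ ν hP).1
    have h₁ := lagrangian_le_G d hμ ν hP hac₀.1 (fun _ => hac₀) hp
    have h₂ := mul_le_mul_of_nonneg_left hD₀ hμ
    have h₃ := h p hp
    linarith
  -- For t above the exponent, weak duality puts the minimal tilted cost below t + νΔ throughout the
  -- ball, as `exists_G_lt` requires.
  · refine iSup₂_le fun ν hν => EReal.le_of_forall_lt_iff_le.1 fun t ht => ?_
    rw [EReal.coe_lt_coe_iff] at ht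
    obtain ⟨μ, hμ, p, hp, hlt⟩ := exists_G_lt d ν hP E (t := t + ν * Δ) hne fun q hq hD => by
      obtain ⟨p, hp, hle⟩ := exists_tiltedCost_le_rateDistortion hd0 hΔ hq.1 hν
      have := hub ⟨q, mem_acSimplex_iff_relEntropy_le.2 ⟨hq, hD⟩, rfl⟩
      exact ⟨p, hp, by linarith⟩
    refine iInf₂_le_of_le μ hμ.le (EReal.coe_le_coe_iff.2 ?_)
    have := (isLeast_minG d hμ.le ν hP).2 ⟨p, hp, rfl⟩
    linarith

end Exponent

end Marton

theorem theorem1 {X Y : Type*} [Fintype X] [Fintype Y]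
    (d : X → Y → ℝ) (hd : ∀ x y, 0 ≤ d x y) (hd0 : ∀ x, ∃ y, d x y = 0)
    (P : X → ℝ) (hP : P ∈ stdSimplex ℝ X)
    (E : ℝ) (hE : 0 ≤ E)
    (Δ : ℝ) (hΔ : 0 ≤ Δ) (hΔmax : Δ ≤ Marton.maxDistortion d P) :
    -- the minimum that defines `R(Δ|q)` is attained
    (∀ q ∈ stdSimplex ℝ X,
      IsLeast (Marton.rateSet d Δ q) (Marton.rateDistortion d Δ q)) ∧
    -- the maximum that defines `R_M(E|Δ,P)` is attained
    IsGreatest (Marton.invMartonSet d E Δ P) (Marton.invMarton d E Δ P) ∧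
    -- the minimum of `G` over `p_Y` is attained, and `G` is convex in `p_Y`
    (∀ μ ν : ℝ, 0 ≤ μ → 0 ≤ ν →
      IsLeast (Marton.G d μ ν P '' stdSimplex ℝ Y) (Marton.minG d μ ν P) ∧
      ConvexOn ℝ (stdSimplex ℝ Y) (Marton.G d μ ν P)) ∧
    -- the parametric expression, with supremum and infimum taken in the extended reals
    (Marton.invMarton d E Δ P : EReal) =
      ⨆ (ν : ℝ) (_ : 0 ≤ ν), ⨅ (μ : ℝ) (_ : 0 ≤ μ),
        ((-ν * Δ + μ * E + Marton.minG d μ ν P : ℝ) : EReal) := by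
  have hX := Marton.nonempty_of_mem_stdSimplex hP
  have hY : Nonempty Y := ⟨(hd0 hX.some).choose⟩
  refine ⟨fun q hq => ?_, Marton.isGreatest_invMarton hd hd0 hP hE hΔ,
    fun μ ν hμ _ => ⟨Marton.isLeast_minG d hμ ν hP, Marton.convexOn_G d hμ ν hP⟩,
    Marton.invMarton_eq_iSup_iInf hd hd0 hP hE hΔ⟩
  obtain ⟨V, hV, hVd, hVR, h⟩ := Marton.exists_rateDistortion_eq hd0 hΔ hq
  exact ⟨⟨V, ⟨hV, hVd⟩, hVR⟩, by rintro _ ⟨W, hW, rfl⟩; exact h W hW.1 hW.2⟩
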